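/- Let $G_n$ ($n\ge 0$) be the Barnes multiple Gamma functions, i.e. the unique meromorphic functions on $\mathbb{C}$ with $G_0(z)=z$, $G_{n}(1)=1$, $G_{n+1}(z+1)=G_{n+1}(z)\,G_n(z)$ and $\frac{d^{n+1}}{dx^{n+1}}\log G_n(x)\ge 0$ for $x\ge 1$ (so $G_1=\Gamma$, and $G_2$ is the Barnes $G$-function); explicitly, with $\binom{z}{j}=z(z-1)\cdots(z-j+1)/j!$, $$G_{n+1}(z)=\lim_{N\to\infty}\frac{\prod_{j=0}^{n+1}G_{n+1-j}(N+1)^{\binom{z}{j}}}{\prod_{i=0}^{N}G_n(z+i)},\qquad z\in\mathbb{C}\setminus\{0,-1,-2,\dots\}.$$ For $n\ge 1$ the function $G_n$ is holomorphic and zero-free on $\mathbb{C}\setminus(-\infty,0]$; let $\log G_n$ denote the holomorphic branch of its logarithm there that is real on $(0,\infty)$, that is, $\log G_n(z)=\int_1^z \frac{G_n'(w)}{G_n(w)}\,dw$ along the segment from $1$ to $z$. With $\operatorname{Log}$ the principal logarithm, put $$f_n(z)=\frac{\log G_n(z+1)}{z^n\operatorname{Log} z},\qquad \operatorname{Im}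 z>0 .$$ Proposition. For all integers $n\ge 1$ and $k\ge 1$ and every real $t\in(-k,-k+1)$, $$\lim_{\substack{z\to t\\ \operatorname{Im} z>0}}\operatorname{Im} f_n(z)=\pi\,\frac{\frac{(-1)^n}{n!}\,(k-1)_n\,\log|t|-\log|G_n(t+1)|}{t^n\big((\log|t|)^2+\pi^2\big)},$$ where $(a)_n=a(a+1)\cdots(a+n-1)$. The limit is over all $z\to t$ in the open upper half plane. -/

import Mathlib

open scoped Topology

noncomputable section

/-- The values of the multiple Gamma functions at the positive integers:
`multiGammaNat n m` is `G_n(m + 1)`, so that `G_0(m + 1) = m + 1` and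
`G_{n+1}(m + 1) = G_n(1) G_n(2) ⋯ G_n(m)`. -/
def multiGammaNat : ℕ → ℕ → ℕ
  | 0, m => m + 1
  | n + 1, m => ∏ i ∈ Finset.range m, multiGammaNat n i

/-- The Barnes multiple Gamma function `G_n` of order `n`, as a function on `ℂ`: the solution of
`G_{n+1}(z + 1) = G_{n+1}(z) G_n(z)`, `G_n(1) = 1`, `G_0(z) = z` that is given by the Gauss product
`G_{n+1}(z) = lim_{N → ∞}
  ∏_{j=0}^{n+1} G_{n+1-j}(N + 1) ^ (z choose j) / (G_n(z) G_n(z + 1) ⋯ G_n(z + N))`.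
For `n = 0` this is the limit of `N! (N + 1) ^ z / (z (z + 1) ⋯ (z + N))`, so `G_1 = Γ`, and `G_2`
is the Barnes `G`-function. As for `Complex.Gamma`, the value at a pole
(one of the points `0, -1, -2, …`) is `0`. -/
def multiGamma : ℕ → ℂ → ℂ
  | 0, z => z
  | n + 1, z => Filter.limUnder Filter.atTop fun N : ℕ =>
      (∏ j ∈ Finset.range (n + 2),
        (multiGammaNat (n + 1 - j) N : ℂ) ^ ((descPochhammer ℂ j).eval z / (j.factorial : ℂ))) /
      ∏ i ∈ Finset.range (N + 1), multiGamma n (z + i)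

theorem multiGammaNat_one (m : ℕ) : multiGammaNat 1 m = m.factorial := by
  simp only [multiGammaNat]
  exact Finset.prod_range_add_one_eq_factorial m

/-- The multiple Gamma function of order `1` is Euler's Gamma function. -/
theorem multiGamma_one : multiGamma 1 = Complex.Gamma := by
  funext z
  rw [multiGamma]
  refine Filter.Tendsto.limUnder_eq ?_
  have h1 : Filter.Tendsto (fun N : ℕ => Complex.GammaSeq z (N + 1)) Filter.atTop
      (𝓝 (Complex.Gamma z)) :=
    (Filter.tendsto_add_atTop_iff_nat 1).2 (Complex.GammaSeq_tendsto_Gamma z)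
  have h2 : Filter.Tendsto (fun N : ℕ => (((N + 1 : ℕ) : ℂ) / (((N + 1 : ℕ) : ℂ) + z))⁻¹)
      Filter.atTop (𝓝 (1 : ℂ)⁻¹) :=
    ((Filter.tendsto_add_atTop_iff_nat 1).2 (tendsto_natCast_div_add_atTop z)).inv₀ one_ne_zero
  have h3 := h1.mul h2
  rw [inv_one, mul_one] at h3
  refine h3.congr' ?_
  obtain ⟨M, hM⟩ := exists_nat_gt ‖z‖
  filter_upwards [Filter.eventually_ge_atTop M] with N hN
  have hz : z + ((N + 1 : ℕ) : ℂ) ≠ 0 := by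
    intro h
    have h4 : z = -((N + 1 : ℕ) : ℂ) := eq_neg_of_add_eq_zero_left h
    rw [h4, norm_neg, Complex.norm_natCast] at hM
    have : N + 1 < M := by exact_mod_cast hM
    omega
  have hN1 : ((N + 1 : ℕ) : ℂ) ≠ 0 := Nat.cast_ne_zero.2 (Nat.succ_ne_zero N)
  rw [Complex.GammaSeq, Finset.prod_range_succ _ (N + 1), Finset.prod_range_succ _ 1,
    Finset.prod_range_one, Nat.sub_zero, Nat.sub_self, multiGammaNat_one, Nat.factorial_succ]
  simp only [descPochhammer_zero, descPochhammer_one, Polynomial.eval_one, Polynomial.eval_X,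
    Nat.factorial_zero, Nat.factorial_one, Nat.cast_one, div_one, Complex.cpow_one,
    multiGammaNat, Nat.cast_mul]
  rw [inv_div, add_comm (((N + 1 : ℕ) : ℂ)) z]
  have h0 : ∀ w : ℂ, multiGamma 0 w = w := fun w => by rw [multiGamma]
  simp only [h0]
  by_cases hP : ∏ i ∈ Finset.range (N + 1), (z + (i : ℂ)) = 0
  · simp [hP]
  · field_simp

/-- The holomorphic branch of `log G_n` on `ℂ ∖ (-∞, 0]` that is real on the positive half line:
the primitive of `G_n' / G_n` which vanishes at `1`, as an integral along the segment from `1`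
to `z`. -/
def logMultiGamma (n : ℕ) (z : ℂ) : ℂ :=
  ∫ s in (0 : ℝ)..1, (z - 1) * logDeriv (multiGamma n) (1 + (s : ℂ) * (z - 1))

/-- `f_n(z) = log G_n(z + 1) / (z ^ n Log z)` on `ℂ ∖ (-∞, 0]`. -/
def pickF (n : ℕ) (z : ℂ) : ℂ :=
  logMultiGamma n (z + 1) / (z ^ n * Complex.log z)

end

/-! The proof constructs a logarithm `multiGammaLog n` of G_n that is holomorphic on the slit plane
and, off 0, -1, -2, ..., continuous on the closed upper half plane. It is the limit of logarithms of
Gauss products, by induction on n. Passing from N to N + 1 changes the logarithm of order n + 1 by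
minus a Newton remainder of order n + 1 of a shift of log G_n (`gaussLog_succ_sub`), because the
iterated differences of log G_n at integers are values of log G_{n-j}. The remainders of order n + d
of log G_n(M + w) are O(M^(-d-1)): for n = 0 this is Taylor's formula, and `limUnder_gaussLog`
carries it through the induction. Hence convergence is locally uniform and preserves holomorphy and
one-sided continuity.

The limit satisfies log G_{n+1}(z + 1) = log G_{n+1}(z) + log G_n(z). Since Im log is π on the
negative axis and every log G_n is real on the positive one, this recursion gives the boundary
imaginary part (`multiGammaLog_im`); the real part is log |G_n|. Dividing by t^n (log |t| + iπ)
yields the formula. -/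

noncomputable section

open Filter Finset

/-! ### Binomial polynomials and Newton interpolation. -/

/-- The generalized binomial coefficient `z choose j` as a complex number. -/
def binomC (j : ℕ) (z : ℂ) : ℂ := (descPochhammer ℂ j).eval z / (j.factorial : ℂ)

theorem binomC_zero (z : ℂ) : binomC 0 z = 1 := by simp [binomC]

theorem binomC_one (z : ℂ) : binomC 1 z = z := by simp [binomC]

theorem continuous_binomC (j : ℕ) : Continuous (binomC j) :=
  (Polynomial.continuous _).div_const _

theorem differentiable_binomC (j : ℕ) : Differentiable ℂ (binomC j) :=
  (Polynomial.differentiable _).div_const _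

theorem binomC_natCast (j i : ℕ) : binomC j (i : ℂ) = (i.choose j : ℂ) := by
  rw [binomC, descPochhammer_eval_eq_descFactorial, Nat.descFactorial_eq_factorial_mul_choose,
    Nat.cast_mul, mul_div_cancel_left₀]
  exact_mod_cast j.factorial_ne_zero

theorem binomC_succ_add_one (j : ℕ) (z : ℂ) :
    binomC (j + 1) (z + 1) = binomC (j + 1) z + binomC j z := by
  have hj : (j.factorial : ℂ) ≠ 0 := by exact_mod_cast j.factorial_ne_zero
  have hj' : (j : ℂ) + 1 ≠ 0 := by exact_mod_cast j.succ_ne_zero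
  have h1 : (descPochhammer ℂ (j + 1)).eval (z + 1) = (z + 1) * (descPochhammer ℂ j).eval z := by
    rw [descPochhammer_succ_left]
    simp
  rw [binomC, binomC, binomC, h1, descPochhammer_succ_eval, Nat.factorial_succ]
  push_cast
  field_simp
  ring

theorem binomC_ofReal_im (j : ℕ) (x : ℝ) : (binomC j (x : ℂ)).im = 0 := by
  have h : binomC j (x : ℂ) = (((descPochhammer ℝ j).eval x / (j.factorial : ℝ) : ℝ) : ℂ) := by
    rw [binomC, ← descPochhammer_map Complex.ofRealHom j, ← Complex.ofRealHom_eq_coe x,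
      Polynomial.eval_map_apply, Complex.ofRealHom_eq_coe]
    push_cast
    rfl
  rw [h, Complex.ofReal_im]

/-- The polynomial whose values are the binomial coefficients `z choose j`. -/
def binomPoly (j : ℕ) : Polynomial ℂ :=
  Polynomial.C ((j.factorial : ℂ)⁻¹) * descPochhammer ℂ j

theorem eval_binomPoly (j : ℕ) (z : ℂ) : (binomPoly j).eval z = binomC j z := by
  simp [binomPoly, binomC, div_eq_inv_mul]

theorem natDegree_binomPoly_le (j : ℕ) : (binomPoly j).natDegree ≤ j :=
  (Polynomial.natDegree_C_mul_le _ _).trans (descPochhammer_natDegree ℂ j).le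

/-- The remainder of Newton's forward interpolation of `f` at the nodes `0, …, m`. -/
def newtonRem (m : ℕ) (f : ℂ → ℂ) (z : ℂ) : ℂ :=
  f z - ∑ j ∈ range (m + 1), binomC j z * (fwdDiff 1)^[j] f 0

theorem newtonRem_add (m : ℕ) (f g : ℂ → ℂ) (z : ℂ) :
    newtonRem m (fun w => f w + g w) z = newtonRem m f z + newtonRem m g z := by
  have h : (fun w => f w + g w) = f + g := rfl
  simp only [newtonRem, h, fwdDiff_iter_add, Pi.add_apply, mul_add, sum_add_distrib]
  ring

theorem newtonRem_neg (m : ℕ) (f : ℂ → ℂ) (z : ℂ) :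
    newtonRem m (fun w => - f w) z = - newtonRem m f z := by
  have h : (fun w => - f w) = (-1 : ℂ) • f := by ext; simp
  simp only [newtonRem, h, fwdDiff_iter_const_smul, Pi.smul_apply, smul_eq_mul]
  rw [neg_sub, ← sub_eq_zero]
  simp only [mul_left_comm _ (-1 : ℂ), ← mul_sum]
  ring

theorem newtonRem_sum {ι : Type*} (m : ℕ) (s : Finset ι) (f : ι → ℂ → ℂ) (z : ℂ) :
    newtonRem m (fun w => ∑ i ∈ s, f i w) z = ∑ i ∈ s, newtonRem m (f i) z := by
  have h : (fun w => ∑ i ∈ s, f i w) = ∑ i ∈ s, f i := by ext; simp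
  simp only [newtonRem, h, fwdDiff_iter_finsetSum, Finset.sum_apply, mul_sum, sum_sub_distrib]
  rw [sum_comm]

/-- Newton's forward interpolation is exact on polynomials of degree at most `m`. -/
theorem newtonRem_polynomial (m : ℕ) (p : Polynomial ℂ) (hp : p.natDegree ≤ m) (z : ℂ) :
    newtonRem m (fun w => p.eval w) z = 0 := by
  set q : Polynomial ℂ := ∑ j ∈ range (m + 1),
    binomPoly j * Polynomial.C ((fwdDiff 1)^[j] (fun w => p.eval w) 0) with hq
  have hqe : ∀ w, q.eval w =
      ∑ j ∈ range (m + 1), binomC j w * (fwdDiff 1)^[j] (fun w => p.eval w) 0 := by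
    intro w
    simp [hq, Polynomial.eval_finsetSum, eval_binomPoly]
  have hdeg : q.natDegree ≤ m := by
    refine Polynomial.natDegree_sum_le_of_forall_le _ _ fun j hj => ?_
    refine (Polynomial.natDegree_mul_C_le _ _).trans ((natDegree_binomPoly_le j).trans ?_)
    exact Nat.lt_succ_iff.1 (mem_range.1 hj)
  -- Both polynomials have degree at most m and agree at the m + 1 nodes 0, ..., m.
  have h0 : p - q = 0 := by
    refine Polynomial.eq_zero_of_natDegree_lt_card_of_eval_eq_zero (p - q)
      (ι := Fin (m + 1)) (f := fun i => ((i : ℕ) : ℂ)) ?_ ?_ ?_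
    · intro a b h
      exact Fin.ext (Nat.cast_injective h)
    · intro i
      have h1 := shift_eq_sum_fwdDiff_iter (1 : ℂ) (fun w => p.eval w) i 0
      rw [Polynomial.eval_sub, hqe, sub_eq_zero]
      simp only [zero_add, nsmul_eq_mul, mul_one] at h1
      rw [h1]
      refine sum_subset_zero_on_sdiff
        (range_subset_range.2 (Nat.succ_le_succ (Nat.lt_succ_iff.1 i.2))) ?_ ?_
      · intro j hj
        rw [Finset.mem_sdiff, mem_range, mem_range, not_lt] at hj
        rw [binomC_natCast, Nat.choose_eq_zero_of_lt hj.2, Nat.cast_zero, zero_mul]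
      · intro j _
        rw [binomC_natCast]
    · rw [Fintype.card_fin]
      exact Nat.lt_succ_of_le ((Polynomial.natDegree_sub_le _ _).trans (max_le hp hdeg))
  rw [newtonRem, ← hqe, ← Polynomial.eval_sub, h0, Polynomial.eval_zero]

theorem norm_fwdDiff_iter_le {m : ℕ} {f : ℂ → ℂ} {B : ℝ} (hf : ∀ i ≤ m, ‖f i‖ ≤ B) (j : ℕ) :
    ∀ i : ℕ, i + j ≤ m → ‖(fwdDiff 1)^[j] f i‖ ≤ 2 ^ j * B := by
  induction j with
  | zero => intro i hi; simpa using hf i hi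
  | succ j ih =>
    intro i hi
    have h1 := ih i (by omega)
    have h2 := ih (i + 1) (by omega)
    rw [Function.iterate_succ_apply', fwdDiff]
    push_cast at h2
    calc _ ≤ 2 ^ j * B + 2 ^ j * B := (norm_sub_le _ _).trans (add_le_add h2 h1)
      _ = _ := by ring

/-- The remainder only sees f at z and at the nodes, with coefficients bounded on the ball; so K is
independent of f and serves all shifts at once. -/
theorem exists_norm_newtonRem_le (m : ℕ) (R : ℝ) : ∃ K : ℝ, 0 ≤ K ∧
    ∀ (f : ℂ → ℂ) (B : ℝ) (z : ℂ), ‖z‖ ≤ R → ‖f z‖ ≤ B → (∀ i : ℕ, i ≤ m → ‖f i‖ ≤ B) →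
      ‖newtonRem m f z‖ ≤ K * B := by
  have hb : ∀ j, ∃ c, ∀ z : ℂ, ‖z‖ ≤ R → ‖binomC j z‖ ≤ c := by
    intro j
    obtain ⟨c, hc⟩ := (isCompact_closedBall (0 : ℂ) R).exists_bound_of_continuousOn
      (continuous_binomC j).continuousOn
    exact ⟨c, fun z hz => hc z (by simpa using hz)⟩
  choose c hc using hb
  refine ⟨1 + ∑ j ∈ range (m + 1), |c j| * 2 ^ j, by positivity, fun f B z hz hfz hf => ?_⟩
  have hB : 0 ≤ B := (norm_nonneg _).trans hfz
  rw [newtonRem, add_mul, one_mul, sum_mul]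
  refine (norm_sub_le _ _).trans (add_le_add hfz ((norm_sum_le _ _).trans (sum_le_sum ?_)))
  intro j hj
  have h1 := norm_fwdDiff_iter_le hf j 0 (by have := mem_range.1 hj; omega)
  rw [Nat.cast_zero] at h1
  rw [norm_mul, mul_assoc]
  exact mul_le_mul ((hc j z hz).trans (le_abs_self _)) h1 (norm_nonneg _) (abs_nonneg _)

theorem tendsto_fwdDiff_iter {F : ℕ → ℂ → ℂ} {f : ℂ → ℂ}
    (h : ∀ i : ℕ, Tendsto (fun N => F N i) atTop (𝓝 (f i))) (j : ℕ) :
    ∀ i : ℕ, Tendsto (fun N => (fwdDiff 1)^[j] (F N) i) atTop (𝓝 ((fwdDiff 1)^[j] f i)) := by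
  induction j with
  | zero => simpa using h
  | succ j ih =>
    intro i
    simp only [Function.iterate_succ_apply', fwdDiff]
    have h2 := ih (i + 1)
    push_cast at h2
    exact h2.sub (ih i)

theorem tendsto_newtonRem (m : ℕ) {F : ℕ → ℂ → ℂ} {f : ℂ → ℂ} {z : ℂ}
    (hz : Tendsto (fun N => F N z) atTop (𝓝 (f z)))
    (h : ∀ i : ℕ, Tendsto (fun N => F N i) atTop (𝓝 (f i))) :
    Tendsto (fun N => newtonRem m (F N) z) atTop (𝓝 (newtonRem m f z)) := by
  refine hz.sub (tendsto_finsetSum _ fun j _ => ?_)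
  have := tendsto_fwdDiff_iter h j 0
  rw [Nat.cast_zero] at this
  exact this.const_mul _

/-! ### Decay of the remainders of the logarithm. -/

/-- The Newton remainders of order `m` of `w ↦ log (M + w)` decay like `M ^ (-m - 1)`. -/
theorem exists_norm_newtonRem_log_le (m : ℕ) (R : ℝ) : ∃ (C : ℝ) (M₀ : ℕ), ∀ M : ℕ, M₀ ≤ M →
    ∀ z : ℂ, ‖z‖ ≤ R → ‖newtonRem m (fun w => Complex.log (M + w)) z‖ ≤ C / (M : ℝ) ^ (m + 1) := by
  obtain ⟨K, hK, hKf⟩ := exists_norm_newtonRem_le m R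
  -- The Taylor error must be controlled at z and also at the nodes up to m; M > 2r keeps |w / M| ≤
  -- 1/2 at all of them.
  set r : ℝ := max R m with hr
  have hr0 : 0 ≤ r := le_max_of_le_right (Nat.cast_nonneg m)
  obtain ⟨M₀, hM₀⟩ := exists_nat_gt (2 * r)
  refine ⟨K * (2 * r ^ (m + 1)), M₀ + 1, fun M hM z hz => ?_⟩
  have hM1 : (M₀ : ℝ) + 1 ≤ M := by exact_mod_cast hM
  have hMpos : (0 : ℝ) < M := by linarith
  have hMC : (M : ℂ) ≠ 0 := by exact_mod_cast hMpos.ne'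
  have hsmall : ∀ w : ℂ, ‖w‖ ≤ r → ‖w / M‖ ≤ 1 / 2 := by
    intro w hw
    rw [norm_div, Complex.norm_natCast, div_le_iff₀ hMpos]
    linarith
  set E : ℂ → ℂ := fun w => Complex.log (M + w) - Complex.log M -
    Complex.logTaylor (m + 1) (w / M) with hE
  have hEle : ∀ w : ℂ, ‖w‖ ≤ r → ‖E w‖ ≤ 2 * r ^ (m + 1) / (M : ℝ) ^ (m + 1) := by
    intro w hw
    have h1 := hsmall w hw
    have h2 : (1 : ℂ) + w / M ≠ 0 := by
      intro h
      rw [eq_neg_of_add_eq_zero_right h, norm_neg, norm_one] at h1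
      norm_num at h1
    have h3 : Complex.log (M + w) = Complex.log M + Complex.log (1 + w / M) := by
      have h4 : (M : ℂ) + w = ((M : ℝ) : ℂ) * (1 + w / M) := by
        push_cast; field_simp
      rw [h4, Complex.log_ofReal_mul hMpos h2, Complex.ofReal_log hMpos.le, Complex.ofReal_natCast]
    have h5 := Complex.norm_log_sub_logTaylor_le m (h1.trans_lt (by norm_num))
    have h6 : (1 - ‖w / M‖)⁻¹ ≤ 2 := by
      rw [inv_le_comm₀ (by linarith) (by norm_num)]
      linarith
    have h7 : ‖w / M‖ ≤ r / M := by
      rw [norm_div, Complex.norm_natCast]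
      gcongr
    rw [hE]
    simp only [h3, add_sub_cancel_left]
    have h8 : 0 ≤ (1 - ‖w / M‖)⁻¹ := inv_nonneg.2 (by linarith)
    have h9 : (0 : ℝ) ≤ m := Nat.cast_nonneg m
    refine h5.trans ((div_le_self (by positivity) (by linarith)).trans ?_)
    calc ‖w / M‖ ^ (m + 1) * (1 - ‖w / M‖)⁻¹ ≤ (r / M) ^ (m + 1) * 2 := by
          gcongr
      _ = _ := by rw [div_pow]; ring
  set p : Polynomial ℂ := Polynomial.C (Complex.log M) + ∑ j ∈ range (m + 1),
    Polynomial.C ((-1) ^ (j + 1) / (j : ℂ) / (M : ℂ) ^ j) * Polynomial.X ^ j with hp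
  have hpe : ∀ w, p.eval w = Complex.log M + Complex.logTaylor (m + 1) (w / M) := by
    intro w
    simp only [hp, Polynomial.eval_add, Polynomial.eval_C, Polynomial.eval_finsetSum,
      Polynomial.eval_mul, Polynomial.eval_pow, Polynomial.eval_X, Complex.logTaylor, div_pow]
    congr 1
    refine sum_congr rfl fun j _ => ?_
    ring
  have hpd : p.natDegree ≤ m := by
    refine Polynomial.natDegree_add_le_of_degree_le (by simp) ?_
    refine Polynomial.natDegree_sum_le_of_forall_le _ _ fun j hj => ?_
    exact (Polynomial.natDegree_C_mul_X_pow_le _ _).trans (Nat.lt_succ_iff.1 (mem_range.1 hj))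
  have hsplit : (fun w : ℂ => Complex.log (M + w)) = fun w => E w + p.eval w := by
    funext w
    rw [hpe, hE]
    ring
  rw [hsplit, newtonRem_add, newtonRem_polynomial m p hpd, add_zero, mul_div_assoc]
  refine hKf E _ z hz (hEle z (hz.trans (le_max_left _ _))) fun i hi => hEle i ?_
  rw [Complex.norm_natCast]
  exact le_max_of_le_right (by exact_mod_cast hi)

/-- Summing over shifts costs exactly one power of M, uniformly in N. This is the loss in passing
from order n to n + 1. -/
theorem sum_range_inv_pow_le (M d N : ℕ) (hM : 1 ≤ M) :
    ∑ i ∈ range N, 1 / (((M + i : ℕ) : ℝ) ^ (d + 2)) ≤ 2 / (M : ℝ) ^ (d + 1) := by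
  have hM0 : (0 : ℝ) < M := by exact_mod_cast hM
  obtain ⟨k, rfl⟩ : ∃ k, M = k + 1 := ⟨M - 1, by omega⟩
  have h1 : ∑ i ∈ range N, (((k + 1 + i : ℕ) : ℝ) ^ 2)⁻¹ ≤ 2 / ((k : ℝ) + 1) := by
    refine le_trans (le_of_eq ?_) (sum_Ioo_inv_sq_le k (k + 1 + N))
    have h2 : Ioo k (k + 1 + N) = Ico (k + 1) (k + 1 + N) := by ext; simp
    rw [h2, sum_Ico_eq_sum_range]
    simp
  calc ∑ i ∈ range N, 1 / (((k + 1 + i : ℕ) : ℝ) ^ (d + 2))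
      ≤ ∑ i ∈ range N, 1 / ((k + 1 : ℕ) : ℝ) ^ d * (((k + 1 + i : ℕ) : ℝ) ^ 2)⁻¹ := by
        refine sum_le_sum fun i _ => ?_
        rw [pow_add, one_div_mul_eq_div, one_div, mul_inv, div_eq_mul_inv, mul_comm]
        have h3 : ((k + 1 : ℕ) : ℝ) ≤ ((k + 1 + i : ℕ) : ℝ) := by exact_mod_cast Nat.le_add_right _ _
        gcongr
    _ ≤ 1 / ((k + 1 : ℕ) : ℝ) ^ d * (2 / ((k : ℝ) + 1)) := by
        rw [← mul_sum]; gcongr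
    _ = _ := by
        push_cast at hM0 ⊢
        rw [pow_succ]
        field_simp

/-! ### Values at integers, Gauss products and the inductive hypothesis. -/

theorem multiGammaNat_pos (n : ℕ) : ∀ m, 0 < multiGammaNat n m := by
  induction n with
  | zero => intro m; simp [multiGammaNat]
  | succ n ih => intro m; rw [multiGammaNat]; exact prod_pos fun i _ => ih i

theorem multiGammaNat_succ_succ (n m : ℕ) :
    multiGammaNat (n + 1) (m + 1) = multiGammaNat (n + 1) m * multiGammaNat n m := by
  rw [multiGammaNat, prod_range_succ, multiGammaNat]

/-- The logarithm of `G_n(m + 1)`. -/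
def logMultiGammaNat (n m : ℕ) : ℂ := Complex.log (multiGammaNat n m : ℂ)

theorem logMultiGammaNat_eq_ofReal (n m : ℕ) :
    logMultiGammaNat n m = (Real.log (multiGammaNat n m) : ℂ) :=
  (Complex.natCast_log).symm

theorem logMultiGammaNat_succ_succ (n m : ℕ) :
    logMultiGammaNat (n + 1) (m + 1) = logMultiGammaNat (n + 1) m + logMultiGammaNat n m := by
  have h1 : (multiGammaNat (n + 1) m : ℝ) ≠ 0 := by exact_mod_cast (multiGammaNat_pos _ _).ne'
  have h2 : (multiGammaNat n m : ℝ) ≠ 0 := by exact_mod_cast (multiGammaNat_pos _ _).ne'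
  simp only [logMultiGammaNat_eq_ofReal]
  rw [multiGammaNat_succ_succ, Nat.cast_mul, Real.log_mul h1 h2, Complex.ofReal_add]

theorem logMultiGammaNat_succ_zero (n : ℕ) : logMultiGammaNat (n + 1) 0 = 0 := by
  simp [logMultiGammaNat, multiGammaNat]

/-- The logarithm of the `N`-th Gauss product of order `n + 1`, where `f` is a logarithm of the
multiple Gamma function of order `n`. -/
def gaussLog (n : ℕ) (f : ℂ → ℂ) (N : ℕ) (z : ℂ) : ℂ :=
  ∑ j ∈ range (n + 2), binomC j z * logMultiGammaNat (n + 1 - j) N -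
    ∑ i ∈ range (N + 1), f (z + i)

/-- The closed upper half plane without the points `0, -1, -2, …`. -/
def upperSlit : Set ℂ := {z | 0 ≤ z.im ∧ ∀ m : ℕ, z ≠ -m}

theorem add_natCast_mem_upperSlit {z : ℂ} (hz : z ∈ upperSlit) (i : ℕ) : z + i ∈ upperSlit := by
  refine ⟨by simpa using hz.1, fun m h => hz.2 (m + i) ?_⟩
  push_cast
  linear_combination h

theorem add_natCast_mem_slitPlane {z : ℂ} (hz : z ∈ Complex.slitPlane) (i : ℕ) :
    z + i ∈ Complex.slitPlane := by
  rw [Complex.mem_slitPlane_iff] at hz ⊢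
  rcases hz with h | h
  · left
    simp only [Complex.add_re, Complex.natCast_re]
    positivity
  · right
    simpa using h

/-- The properties of a logarithm of the multiple Gamma function of order `n` which suffice to
construct one of order `n + 1`. -/
structure IsMultiGammaLog (n : ℕ) (f : ℂ → ℂ) : Prop where
  differentiableOn : DifferentiableOn ℂ f Complex.slitPlane
  continuousOn : ContinuousOn f upperSlit
  im_eq_zero : ∀ x : ℝ, 0 < x → (f x).im = 0
  natCast_add_one : ∀ m : ℕ, f (m + 1) = logMultiGammaNat n m
  newtonRem_le : ∀ (d : ℕ) (R : ℝ), ∃ (C : ℝ) (M₀ : ℕ), ∀ M : ℕ, M₀ ≤ M → ∀ z : ℂ, ‖z‖ ≤ R →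
    ‖newtonRem (n + d) (fun w => f (M + w)) z‖ ≤ C / (M : ℝ) ^ (d + 1)

theorem isMultiGammaLog_log : IsMultiGammaLog 0 Complex.log where
  differentiableOn := fun z hz =>
    (Complex.differentiableAt_log hz).differentiableWithinAt
  continuousOn := by
    intro z hz
    by_cases hs : z ∈ Complex.slitPlane
    · exact (continuousAt_clog hs).continuousWithinAt
    · rw [Complex.mem_slitPlane_iff, not_or, not_lt, not_not] at hs
      have hre : z.re ≠ 0 := fun h => hz.2 0 (by simpa using Complex.ext h hs.2)
      -- On the negative axis the principal value has argument π, the limit from above.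
      exact (Complex.continuousWithinAt_log_of_re_neg_of_im_zero
        (lt_of_le_of_ne hs.1 hre) hs.2).mono fun w hw => hw.1
  im_eq_zero := fun x hx => by rw [← Complex.ofReal_log hx.le, Complex.ofReal_im]
  natCast_add_one := fun m => by simp [logMultiGammaNat, multiGammaNat]
  newtonRem_le := fun d R => by
    simpa only [Nat.zero_add] using exists_norm_newtonRem_log_le d R

/-! ### The inductive step from order n to order n + 1. -/

namespace IsMultiGammaLog

variable {n : ℕ} {f : ℂ → ℂ}

/-- On integers each difference lowers the order by one, which is possible until order 0 is reached.
-/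
theorem fwdDiff_iter (hf : IsMultiGammaLog n f) (N : ℕ) {j : ℕ} : j ≤ n → ∀ i : ℕ,
    (fwdDiff 1)^[j] (fun w => f (((N + 1 : ℕ) : ℂ) + w)) i = logMultiGammaNat (n - j) (N + i) := by
  induction j with
  | zero =>
    intro _ i
    rw [Function.iterate_zero, id, Nat.sub_zero, ← hf.natCast_add_one]
    push_cast
    ring_nf
  | succ j ih =>
    intro hj i
    have h1 := ih (by omega) i
    have h2 := ih (by omega) (i + 1)
    obtain ⟨q, hq⟩ : ∃ q, n - j = q + 1 := ⟨n - j - 1, by omega⟩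
    rw [hq] at h1 h2
    rw [Nat.cast_succ i, ← add_assoc] at h2
    rw [Function.iterate_succ_apply', fwdDiff, h1, h2, logMultiGammaNat_succ_succ, show n - (j + 1) = q by omega]
    ring

theorem fwdDiff_iter_zero (hf : IsMultiGammaLog n f) (N : ℕ) {j : ℕ} (hj : j ≤ n) :
    (fwdDiff 1)^[j] (fun w => f (((N + 1 : ℕ) : ℂ) + w)) 0 = logMultiGammaNat (n - j) N := by
  simpa using hf.fwdDiff_iter N hj 0

theorem fwdDiff_iter_succ_zero (hf : IsMultiGammaLog n f) (N : ℕ) :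
    (fwdDiff 1)^[n + 1] (fun w => f (((N + 1 : ℕ) : ℂ) + w)) 0 =
      logMultiGammaNat 0 (N + 1) - logMultiGammaNat 0 N := by
  have h := hf.fwdDiff_iter N le_rfl 1
  rw [Function.iterate_succ_apply', fwdDiff, hf.fwdDiff_iter_zero N le_rfl, zero_add, Nat.sub_self]
  simpa using h

/-- The exponents in the Gauss product are chosen so that their increments in N are the Newton
coefficients of the new factor. -/
theorem gaussLog_succ_sub (hf : IsMultiGammaLog n f) (N : ℕ) (z : ℂ) :
    gaussLog n f (N + 1) z - gaussLog n f N z =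
      - newtonRem (n + 1) (fun w => f (((N + 1 : ℕ) : ℂ) + w)) z := by
  have h : ∑ j ∈ range (n + 2), binomC j z * logMultiGammaNat (n + 1 - j) (N + 1) -
      ∑ j ∈ range (n + 2), binomC j z * logMultiGammaNat (n + 1 - j) N =
      ∑ j ∈ range (n + 2),
        binomC j z * (fwdDiff 1)^[j] (fun w => f (((N + 1 : ℕ) : ℂ) + w)) 0 := by
    rw [← sum_sub_distrib]
    refine sum_congr rfl fun j hj => ?_
    rw [← mul_sub]
    congr 1
    rcases (Nat.lt_succ_iff.1 (mem_range.1 hj)).eq_or_lt with rfl | hj'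
    · rw [hf.fwdDiff_iter_succ_zero, Nat.sub_self]
    · rw [hf.fwdDiff_iter_zero N (by omega), show n + 1 - j = n - j + 1 by omega,
        logMultiGammaNat_succ_succ]
      ring
  rw [newtonRem, ← h, gaussLog, gaussLog, sum_range_succ _ (N + 1), add_comm z]
  ring

/-- By Pascal's rule and a telescoping sum, the functional equation holds up to a remainder of order
n, which vanishes in the limit. -/
theorem gaussLog_add_one (hf : IsMultiGammaLog n f) (N : ℕ) (z : ℂ) :
    gaussLog n f N (z + 1) =
      gaussLog n f N z + f z - newtonRem n (fun w => f (((N + 1 : ℕ) : ℂ) + w)) z := by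
  have h : ∑ j ∈ range (n + 2), binomC j (z + 1) * logMultiGammaNat (n + 1 - j) N =
      ∑ j ∈ range (n + 2), binomC j z * logMultiGammaNat (n + 1 - j) N +
      ∑ j ∈ range (n + 1),
        binomC j z * (fwdDiff 1)^[j] (fun w => f (((N + 1 : ℕ) : ℂ) + w)) 0 := by
    rw [sum_range_succ' _ (n + 1), sum_range_succ' _ (n + 1), binomC_zero, binomC_zero,
      add_right_comm, ← sum_add_distrib]
    congr 1
    refine sum_congr rfl fun j hj => ?_
    rw [hf.fwdDiff_iter_zero N (Nat.lt_succ_iff.1 (mem_range.1 hj)), binomC_succ_add_one,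
      Nat.add_sub_add_right]
    ring
  have h2 : ∑ i ∈ range (N + 1), f (z + 1 + i) =
      ∑ i ∈ range (N + 1), f (z + i) + f (((N + 1 : ℕ) : ℂ) + z) - f z := by
    rw [add_comm _ z, ← sum_range_succ (fun i : ℕ => f (z + i)), sum_range_succ' _ (N + 1)]
    simp only [Nat.cast_zero, add_zero, add_sub_cancel_right]
    refine sum_congr rfl fun i _ => ?_
    push_cast
    ring_nf
  rw [newtonRem, gaussLog, gaussLog, h, h2]
  ring

theorem tendstoUniformlyOn_gaussLog (hf : IsMultiGammaLog n f) (R : ℝ) :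
    TendstoUniformlyOn (gaussLog n f)
      (fun z => limUnder atTop fun N => gaussLog n f N z) atTop (Metric.ball 0 R) := by
  -- With d = 1 the increments are O(N^(-2)), hence summable.
  obtain ⟨C, M₀, hC⟩ := hf.newtonRem_le 1 R
  have hu : Summable fun i : ℕ => C * (1 / ((i + 1 : ℕ) : ℝ) ^ 2) :=
    ((summable_nat_add_iff 1).2 (Real.summable_one_div_nat_pow.2 one_lt_two)).mul_left C
  have h1 := tendstoUniformlyOn_tsum_nat_eventually
    (f := fun i z => gaussLog n f (i + 1) z - gaussLog n f i z) (s := Metric.ball 0 R) hu (by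
      filter_upwards [eventually_ge_atTop M₀] with i hi z hz
      rw [hf.gaussLog_succ_sub, norm_neg, mul_one_div]
      exact hC (i + 1) (by omega) z (by simpa using (mem_ball_zero_iff.1 hz).le))
  have h2 : TendstoUniformlyOn (gaussLog n f) (fun z => gaussLog n f 0 z +
      ∑' i, (gaussLog n f (i + 1) z - gaussLog n f i z)) atTop (Metric.ball 0 R) := by
    rw [Metric.tendstoUniformlyOn_iff] at h1 ⊢
    intro ε hε
    filter_upwards [h1 ε hε] with N hN z hz
    have h3 := hN z hz
    rw [sum_range_sub (fun i => gaussLog n f i z)] at h3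
    rw [dist_eq_norm] at h3 ⊢
    rwa [show ∀ a b c : ℂ, a + b - c = b - (c - a) by intros; ring]
  refine h2.congr_right fun z hz => ?_
  exact (h2.tendsto_at hz).limUnder_eq.symm

theorem tendsto_gaussLog (hf : IsMultiGammaLog n f) (z : ℂ) :
    Tendsto (fun N => gaussLog n f N z) atTop (𝓝 (limUnder atTop fun N => gaussLog n f N z)) :=
  (hf.tendstoUniformlyOn_gaussLog (‖z‖ + 1)).tendsto_at (by simp)

theorem limUnder_gaussLog_add_one (hf : IsMultiGammaLog n f) (z : ℂ) :
    (limUnder atTop fun N => gaussLog n f N (z + 1)) =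
      (limUnder atTop fun N => gaussLog n f N z) + f z := by
  obtain ⟨C, M₀, hC⟩ := hf.newtonRem_le 0 ‖z‖
  have h0 : Tendsto (fun N : ℕ => newtonRem n (fun w => f (((N + 1 : ℕ) : ℂ) + w)) z) atTop
      (𝓝 0) := by
    have hlim : Tendsto (fun N : ℕ => C / ((N + 1 : ℕ) : ℝ)) atTop (𝓝 0) :=
      (tendsto_add_atTop_iff_nat 1).2 (tendsto_const_div_atTop_nhds_zero_nat C)
    refine squeeze_zero_norm' ?_ hlim
    filter_upwards [eventually_ge_atTop M₀] with N hN
    simpa using hC (N + 1) (by omega) z le_rfl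
  have h1 := ((hf.tendsto_gaussLog z).add_const (f z)).sub h0
  rw [sub_zero] at h1
  simp only [← hf.gaussLog_add_one] at h1
  exact h1.limUnder_eq

/-- At z = 1 only the binomials with j = 0, 1 survive, and they cancel f(1) + ... + f(N + 1). -/
theorem gaussLog_one (hf : IsMultiGammaLog n f) (N : ℕ) : gaussLog n f N 1 = 0 := by
  have h1 : ∀ N, ∑ i ∈ range N, f (1 + i) = logMultiGammaNat (n + 1) N := by
    intro N
    induction N with
    | zero => rw [sum_range_zero, logMultiGammaNat_succ_zero]
    | succ N ih => rw [sum_range_succ, ih, logMultiGammaNat_succ_succ, add_comm 1,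
        hf.natCast_add_one]
  have h2 : ∑ j ∈ range n, binomC (j + 1 + 1) 1 * logMultiGammaNat (n + 1 - (j + 1 + 1)) N = 0 := by
    refine sum_eq_zero fun j _ => ?_
    rw [← Nat.cast_one (R := ℂ), binomC_natCast, Nat.choose_eq_zero_of_lt (by omega), Nat.cast_zero,
      zero_mul]
  rw [gaussLog, h1, sum_range_succ', sum_range_succ', h2, logMultiGammaNat_succ_succ, binomC_zero,
    zero_add, binomC_one, zero_add, Nat.add_sub_cancel]
  simp [add_comm]

/-- The binomial part is a polynomial in z of degree at most n + 1 ≤ m, so interpolation annihilates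
it. -/
theorem newtonRem_gaussLog (n m : ℕ) (f : ℂ → ℂ) (h : n + 1 ≤ m) (N M : ℕ) (z : ℂ) :
    newtonRem m (fun w => gaussLog n f N (M + w)) z =
      - ∑ i ∈ range (N + 1), newtonRem m (fun w => f (((M + i : ℕ) : ℂ) + w)) z := by
  set p : Polynomial ℂ := (∑ j ∈ range (n + 2),
    binomPoly j * Polynomial.C (logMultiGammaNat (n + 1 - j) N)).comp
      (Polynomial.X + Polynomial.C (M : ℂ)) with hp
  have hpd : p.natDegree ≤ m := by
    rw [hp, Polynomial.natDegree_comp, Polynomial.natDegree_X_add_C, mul_one]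
    refine Polynomial.natDegree_sum_le_of_forall_le _ _ fun j hj => ?_
    refine (Polynomial.natDegree_mul_C_le _ _).trans ((natDegree_binomPoly_le j).trans ?_)
    have := mem_range.1 hj
    omega
  have hs : (fun w => gaussLog n f N (M + w)) = fun w => p.eval w +
      -∑ i ∈ range (N + 1), f (((M + i : ℕ) : ℂ) + w) := by
    funext w
    rw [gaussLog, sub_eq_add_neg, hp, Polynomial.eval_comp, Polynomial.eval_finsetSum]
    simp only [Polynomial.eval_mul, eval_binomPoly, Polynomial.eval_C, Polynomial.eval_add,
      Polynomial.eval_X, add_comm w, Nat.cast_add]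
    simp only [add_right_comm]
  rw [hs, newtonRem_add, newtonRem_polynomial m p hpd, zero_add, newtonRem_neg, newtonRem_sum]

theorem limUnder_gaussLog (hf : IsMultiGammaLog n f) :
    IsMultiGammaLog (n + 1) fun z => limUnder atTop fun N => gaussLog n f N z where
  differentiableOn := by
    have hd : ∀ N, DifferentiableOn ℂ (gaussLog n f N) Complex.slitPlane := by
      intro N
      refine DifferentiableOn.sub (DifferentiableOn.fun_sum fun j _ =>
        ((differentiable_binomC j).mul_const _).differentiableOn)
        (DifferentiableOn.fun_sum fun i _ => ?_)
      exact hf.differentiableOn.comp (differentiable_id.add_const _).differentiableOn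
        fun z hz => add_natCast_mem_slitPlane hz i
    intro z hz
    have hopen : IsOpen (Complex.slitPlane ∩ Metric.ball 0 (‖z‖ + 1)) :=
      Complex.isOpen_slitPlane.inter Metric.isOpen_ball
    have hzm : z ∈ Complex.slitPlane ∩ Metric.ball 0 (‖z‖ + 1) := ⟨hz, by simp⟩
    have h := ((hf.tendstoUniformlyOn_gaussLog (‖z‖ + 1)).mono
      Set.inter_subset_right).tendstoLocallyUniformlyOn.differentiableOn
      (Eventually.of_forall fun N => (hd N).mono Set.inter_subset_left) hopen
    exact (h.differentiableAt (hopen.mem_nhds hzm)).differentiableWithinAt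
  continuousOn := by
    have hd : ∀ N, ContinuousOn (gaussLog n f N) upperSlit := by
      intro N
      refine ContinuousOn.sub (continuousOn_finsetSum _ fun j _ =>
        ((continuous_binomC j).mul continuous_const).continuousOn)
        (continuousOn_finsetSum _ fun i _ => ?_)
      exact hf.continuousOn.comp (continuous_id.add continuous_const).continuousOn
        fun z hz => add_natCast_mem_upperSlit hz i
    intro z hz
    have h := ((hf.tendstoUniformlyOn_gaussLog (‖z‖ + 1)).mono
      (s' := upperSlit ∩ Metric.ball 0 (‖z‖ + 1)) Set.inter_subset_right).continuousOn
      (Eventually.of_forall fun N => (hd N).mono Set.inter_subset_left).frequently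
    exact (h z ⟨hz, by simp⟩).mono_of_mem_nhdsWithin
      (inter_mem_nhdsWithin _ (Metric.isOpen_ball.mem_nhds (by simp)))
  im_eq_zero := by
    intro x hx
    have h1 : ∀ N, (gaussLog n f N x).im = 0 := by
      intro N
      rw [gaussLog, Complex.sub_im, Complex.im_sum, Complex.im_sum, sum_eq_zero, sum_eq_zero,
        sub_zero]
      · intro i _
        have h := hf.im_eq_zero (x + i) (by positivity)
        push_cast at h
        exact h
      · intro j _
        rw [Complex.mul_im, binomC_ofReal_im, logMultiGammaNat_eq_ofReal, Complex.ofReal_im]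
        simp
    have h2 := (Complex.continuous_im.tendsto _).comp (hf.tendsto_gaussLog x)
    refine tendsto_nhds_unique h2 ?_
    simp only [Function.comp_def, h1]
    exact tendsto_const_nhds
  natCast_add_one := by
    intro m
    induction m with
    | zero =>
      simp only [Nat.cast_zero, zero_add, hf.gaussLog_one, logMultiGammaNat_succ_zero]
      exact tendsto_const_nhds.limUnder_eq
    | succ m ih =>
      push_cast
      rw [hf.limUnder_gaussLog_add_one, ih, hf.natCast_add_one, logMultiGammaNat_succ_succ]
  newtonRem_le := by
    intro d R
    -- Same interpolation order, n + (d + 1) = (n + 1) + d; the extra power of decay pays for the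
    -- sum over shifts.
    obtain ⟨C, M₀, hC⟩ := hf.newtonRem_le (d + 1) R
    refine ⟨|C| * 2, M₀ + 1, fun M hM z hz => ?_⟩
    have hlim := tendsto_newtonRem (n + 1 + d) (z := z)
      (F := fun N w => gaussLog n f N (M + w))
      (f := fun w => limUnder atTop fun N => gaussLog n f N (M + w))
      (hf.tendsto_gaussLog _) (fun i => hf.tendsto_gaussLog _)
    refine le_of_tendsto hlim.norm (Eventually.of_forall fun N => ?_)
    rw [newtonRem_gaussLog n _ f (by omega), norm_neg]
    calc _ ≤ ∑ i ∈ range (N + 1), |C| * (1 / ((M + i : ℕ) : ℝ) ^ (d + 2)) := by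
          refine (norm_sum_le _ _).trans (sum_le_sum fun i _ => ?_)
          have h := hC (M + i) (by omega) z hz
          rw [show n + (d + 1) = n + 1 + d by omega] at h
          rw [mul_one_div]
          refine h.trans ?_
          gcongr
          exact le_abs_self C
      _ ≤ |C| * (2 / (M : ℝ) ^ (d + 1)) := by
          rw [← mul_sum]
          exact mul_le_mul_of_nonneg_left (sum_range_inv_pow_le M d _ (by omega)) (abs_nonneg C)
      _ = _ := by ring

end IsMultiGammaLog

/-! ### The logarithm of G_n and its agreement with the integral definition. -/

/-- A logarithm of the multiple Gamma function of order `n`, as the limit of the logarithms of the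
Gauss products; on the negative half line it takes the boundary values from above. -/
def multiGammaLog : ℕ → ℂ → ℂ
  | 0 => Complex.log
  | n + 1 => fun z => limUnder atTop fun N => gaussLog n (multiGammaLog n) N z

theorem isMultiGammaLog_multiGammaLog (n : ℕ) : IsMultiGammaLog n (multiGammaLog n) := by
  induction n with
  | zero => exact isMultiGammaLog_log
  | succ n ih => exact ih.limUnder_gaussLog

theorem multiGammaLog_succ_add_one (n : ℕ) (z : ℂ) :
    multiGammaLog (n + 1) (z + 1) = multiGammaLog (n + 1) z + multiGammaLog n z :=
  (isMultiGammaLog_multiGammaLog n).limUnder_gaussLog_add_one z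

theorem multiGammaLog_succ_one (n : ℕ) : multiGammaLog (n + 1) 1 = 0 := by
  simpa [logMultiGammaNat_succ_zero] using
    (isMultiGammaLog_multiGammaLog (n + 1)).natCast_add_one 0

/-- The Gauss product converges, and its limit is the exponential of `multiGammaLog`. -/
theorem multiGamma_eq_exp (n : ℕ) : ∀ z : ℂ, (∀ m : ℕ, z ≠ -m) →
    multiGamma n z = Complex.exp (multiGammaLog n z) := by
  induction n with
  | zero =>
    intro z hz
    rw [multiGamma, multiGammaLog, Complex.exp_log (by simpa using hz 0)]
  | succ n ih =>
    intro z hz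
    rw [multiGamma]
    refine Tendsto.limUnder_eq ?_
    refine ((Complex.continuous_exp.tendsto _).comp
      ((isMultiGammaLog_multiGammaLog n).tendsto_gaussLog z)).congr fun N => ?_
    rw [Function.comp_apply, gaussLog, Complex.exp_sub, Complex.exp_sum, Complex.exp_sum]
    congr 1
    · refine prod_congr rfl fun j _ => ?_
      rw [Complex.cpow_def_of_ne_zero (by exact_mod_cast (multiGammaNat_pos _ _).ne'), mul_comm]
      rfl
    · refine prod_congr rfl fun i _ => (ih _ fun m h => hz (m + i) ?_).symm
      push_cast
      linear_combination h

theorem ne_neg_natCast_of_mem_slitPlane {z : ℂ} (hz : z ∈ Complex.slitPlane) (m : ℕ) :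
    z ≠ -m := by
  rintro rfl
  rw [Complex.mem_slitPlane_iff] at hz
  simp only [Complex.neg_re, Complex.natCast_re, Complex.neg_im, Complex.natCast_im, neg_zero,
    ne_eq, not_true_eq_false, or_false] at hz
  linarith [(Nat.cast_nonneg m : (0 : ℝ) ≤ m)]

theorem segment_one_mem_slitPlane {z : ℂ} (hz : z ∈ Complex.slitPlane) {s : ℝ}
    (hs : s ∈ Set.Icc (0 : ℝ) 1) : 1 + (s : ℂ) * (z - 1) ∈ Complex.slitPlane := by
  have h := Complex.starConvex_one_slitPlane hz (a := 1 - s) (b := s) (by linarith [hs.2]) hs.1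
    (by ring)
  convert h using 1
  simp only [Complex.real_smul]
  push_cast
  ring

theorem logDeriv_multiGamma (n : ℕ) {z : ℂ} (hz : z ∈ Complex.slitPlane) :
    logDeriv (multiGamma n) z = deriv (multiGammaLog n) z := by
  have h1 : multiGamma n =ᶠ[𝓝 z] fun w => Complex.exp (multiGammaLog n w) := by
    filter_upwards [Complex.isOpen_slitPlane.mem_nhds hz] with w hw
    exact multiGamma_eq_exp n w (ne_neg_natCast_of_mem_slitPlane hw)
  have h2 : DifferentiableAt ℂ (multiGammaLog n) z :=
    (isMultiGammaLog_multiGammaLog n).differentiableOn.differentiableAt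
      (Complex.isOpen_slitPlane.mem_nhds hz)
  rw [logDeriv_apply, h1.deriv_eq, h1.eq_of_nhds, deriv_cexp h2,
    mul_div_cancel_left₀ _ (Complex.exp_ne_zero _)]

/-- The slit plane is star-shaped about 1, so the fundamental theorem of calculus applies along the
segment, and the primitive vanishes at 1. -/
theorem logMultiGamma_eq (n : ℕ) {z : ℂ} (hz : z ∈ Complex.slitPlane) :
    logMultiGamma (n + 1) z = multiGammaLog (n + 1) z := by
  set L := multiGammaLog (n + 1) with hL
  have hd : DifferentiableOn ℂ L Complex.slitPlane :=
    (isMultiGammaLog_multiGammaLog (n + 1)).differentiableOn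
  have hderiv : ∀ s ∈ Set.uIcc (0 : ℝ) 1, HasDerivAt (fun s : ℝ => L (1 + (s : ℂ) * (z - 1)))
      ((z - 1) * logDeriv (multiGamma (n + 1)) (1 + (s : ℂ) * (z - 1))) s := by
    intro s hs
    rw [Set.uIcc_of_le zero_le_one] at hs
    have hm := segment_one_mem_slitPlane hz hs
    rw [logDeriv_multiGamma (n + 1) hm, mul_comm]
    have h1 := (hd.differentiableAt (Complex.isOpen_slitPlane.mem_nhds hm)).hasDerivAt
    have h2 : HasDerivAt (fun s : ℝ => 1 + (s : ℂ) * (z - 1)) (z - 1) s := by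
      simpa using ((Complex.ofRealCLM.hasDerivAt (x := s)).mul_const (z - 1)).const_add 1
    exact h1.comp s h2
  have hcont : ContinuousOn (fun s : ℝ =>
      (z - 1) * logDeriv (multiGamma (n + 1)) (1 + (s : ℂ) * (z - 1))) (Set.uIcc 0 1) := by
    rw [Set.uIcc_of_le zero_le_one]
    have h1 : ContinuousOn (logDeriv (multiGamma (n + 1))) Complex.slitPlane :=
      (hd.deriv Complex.isOpen_slitPlane).continuousOn.congr fun w hw =>
        logDeriv_multiGamma (n + 1) hw
    refine continuousOn_const.mul (h1.comp (by fun_prop) fun s hs => ?_)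
    exact segment_one_mem_slitPlane hz hs
  rw [logMultiGamma, intervalIntegral.integral_eq_sub_of_hasDerivAt hderiv
    hcont.intervalIntegrable]
  simp [hL, multiGammaLog_succ_one]

/-! ### Boundary values from above. -/

theorem ascPochhammer_eval_mul_eq (n : ℕ) (x : ℝ) :
    (ascPochhammer ℝ (n + 1)).eval x = x * (ascPochhammer ℝ n).eval (x + 1) := by
  rw [ascPochhammer_succ_left]
  simp

/-- The imaginary part of the boundary values from above of the logarithm of the multiple Gamma
function on the interval `(-p, -p + 1)`. -/
theorem multiGammaLog_im (p : ℕ) : ∀ n : ℕ, (n ≠ 0 ∨ p ≠ 0) → ∀ x : ℝ,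
    x ∈ Set.Ioo (-(p : ℝ)) (-(p : ℝ) + 1) → (multiGammaLog n x).im =
      Real.pi * ((-1 : ℝ) ^ n / (n.factorial : ℝ) * (ascPochhammer ℝ n).eval (p : ℝ)) := by
  induction p with
  | zero =>
    intro n hn x hx
    -- The pair n = p = 0 is excluded because the formula would give π on (0, 1), where log is real.
    have hn0 : n ≠ 0 := by simpa using hn
    rw [(isMultiGammaLog_multiGammaLog n).im_eq_zero x (by simpa using hx.1), Nat.cast_zero,
      ascPochhammer_ne_zero_eval_zero ℝ hn0]
    simp
  | succ p ihp =>
    intro n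
    induction n with
    | zero =>
      intro _ x hx
      have hx0 : x < 0 := by
        have h := hx.2
        push_cast at h
        linarith [(Nat.cast_nonneg p : (0 : ℝ) ≤ p)]
      rw [multiGammaLog, Complex.log_im, Complex.arg_ofReal_of_neg hx0]
      simp
    | succ n ihn =>
      intro _ x hx
      have hx' : x + 1 ∈ Set.Ioo (-(p : ℝ)) (-(p : ℝ) + 1) := by
        obtain ⟨h1, h2⟩ := hx
        push_cast at h1 h2
        exact ⟨by linarith, by linarith⟩
      have h1 := ihp (n + 1) (Or.inl n.succ_ne_zero) (x + 1) hx'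
      have h2 := ihn (Or.inr p.succ_ne_zero) x hx
      -- The recursion reduces to (p+1)_{n+1}/(n+1)! = (p)_{n+1}/(n+1)! + (p+1)_n/n!, Pascal's rule
      -- with alternating signs.
      have h3 := congrArg Complex.im (multiGammaLog_succ_add_one n x)
      push_cast at h1 h2
      rw [Complex.add_im, h1, h2] at h3
      have h4 : (ascPochhammer ℝ (n + 1)).eval ((p : ℝ) + 1) =
          (ascPochhammer ℝ n).eval ((p : ℝ) + 1) * ((p : ℝ) + 1 + n) :=
        ascPochhammer_succ_eval n _
      have hn1 : (n.factorial : ℝ) ≠ 0 := by exact_mod_cast n.factorial_ne_zero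
      have hn2 : (n : ℝ) + 1 ≠ 0 := by exact_mod_cast n.succ_ne_zero
      rw [ascPochhammer_eval_mul_eq, Nat.factorial_succ] at h3
      rw [Nat.factorial_succ]
      push_cast at h3 ⊢
      rw [h4, eq_sub_of_add_eq h3.symm]
      field_simp
      ring

theorem multiGammaLog_re (n : ℕ) {z : ℂ} (hz : ∀ m : ℕ, z ≠ -m) :
    (multiGammaLog n z).re = Real.log ‖multiGamma n z‖ := by
  rw [multiGamma_eq_exp n z hz, Complex.norm_exp, Real.log_exp]

theorem im_div_pow_mul_log {w : ℂ} {t : ℝ} (ht : t < 0) (n : ℕ) :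
    (w / ((t : ℂ) ^ n * Complex.log t)).im =
      (w.im * Real.log |t| - w.re * Real.pi) / (t ^ n * (Real.log |t| ^ 2 + Real.pi ^ 2)) := by
  have h1 : Complex.log t = ⟨Real.log |t|, Real.pi⟩ := by
    apply Complex.ext
    · rw [Complex.log_re, Complex.norm_real, Real.norm_eq_abs]
    · rw [Complex.log_im, Complex.arg_ofReal_of_neg ht]
  have h2 : w / ((t : ℂ) ^ n * Complex.log t) =
      (((t ^ n)⁻¹ : ℝ) : ℂ) * (w / Complex.log t) := by
    push_cast
    rw [div_mul_eq_div_div_swap, div_eq_inv_mul]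
  have h3 : Complex.normSq (⟨Real.log |t|, Real.pi⟩ : ℂ) = Real.log |t| ^ 2 + Real.pi ^ 2 := by
    rw [Complex.normSq_mk]
    ring
  rw [h2, Complex.im_ofReal_mul, Complex.div_im, h1, h3, ← sub_div, inv_mul_eq_div, div_div,
    mul_comm (t ^ n)]

/-- Numerator and logarithm carry on the negative axis their boundary values from above, so the
limit is plain substitution; log t ≠ 0 because its imaginary part is π. -/
theorem tendsto_pickF (n : ℕ) {t : ℝ} (ht : t < 0) (hm : ∀ m : ℕ, (t : ℂ) + 1 ≠ -m) :
    Tendsto (pickF (n + 1)) (𝓝[{z : ℂ | 0 < z.im}] (t : ℂ))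
      (𝓝 (multiGammaLog (n + 1) (t + 1) / ((t : ℂ) ^ (n + 1) * Complex.log t))) := by
  have hlog : Tendsto Complex.log (𝓝[{z : ℂ | 0 < z.im}] (t : ℂ)) (𝓝 (Complex.log t)) :=
    (Complex.continuousWithinAt_log_of_re_neg_of_im_zero (by simpa using ht)
      (Complex.ofReal_im t)).mono fun z (hz : 0 < z.im) => hz.le
  have hG : Tendsto (fun z => multiGammaLog (n + 1) (z + 1)) (𝓝[{z : ℂ | 0 < z.im}] (t : ℂ))
      (𝓝 (multiGammaLog (n + 1) (t + 1))) := by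
    have h1 : (t : ℂ) + 1 ∈ upperSlit := ⟨by simp, hm⟩
    refine ((isMultiGammaLog_multiGammaLog (n + 1)).continuousOn _ h1).tendsto.comp ?_
    refine tendsto_nhdsWithin_iff.2
      ⟨((continuous_id.add continuous_const).tendsto (t : ℂ)).mono_left nhdsWithin_le_nhds, ?_⟩
    filter_upwards [self_mem_nhdsWithin] with z (hz : 0 < z.im)
    refine ⟨by simpa using hz.le, fun m h => hz.ne' ?_⟩
    simpa using congrArg Complex.im h
  have hpow : Tendsto (fun z : ℂ => z ^ (n + 1)) (𝓝[{z : ℂ | 0 < z.im}] (t : ℂ))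
      (𝓝 ((t : ℂ) ^ (n + 1))) :=
    ((continuous_pow (n + 1)).tendsto _).mono_left nhdsWithin_le_nhds
  have hden : (t : ℂ) ^ (n + 1) * Complex.log t ≠ 0 := by
    refine mul_ne_zero (pow_ne_zero _ (by exact_mod_cast ht.ne)) fun h => ?_
    have h1 := congrArg Complex.im h
    rw [Complex.log_im, Complex.arg_ofReal_of_neg ht, Complex.zero_im] at h1
    exact Real.pi_ne_zero h1
  refine (hG.div (hpow.mul hlog) hden).congr' ?_
  filter_upwards [self_mem_nhdsWithin] with z (hz : 0 < z.im)
  rw [pickF, logMultiGamma_eq n]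
  · rfl
  · exact Complex.mem_slitPlane_iff.2 (Or.inr (by simpa using hz.ne'))

end

theorem mainTheorem4 (n k : ℕ) (hn : 1 ≤ n) (hk : 1 ≤ k) (t : ℝ)
    (ht : t ∈ Set.Ioo (-(k : ℝ)) (-(k : ℝ) + 1)) :
    Filter.Tendsto (fun z : ℂ => (pickF n z).im) (𝓝[{z : ℂ | 0 < z.im}] (t : ℂ))
      (𝓝 (Real.pi *
        (((-1 : ℝ) ^ n / (n.factorial : ℝ) * (ascPochhammer ℝ n).eval ((k : ℝ) - 1)
            * Real.log |t| - Real.log ‖multiGamma n ((t : ℂ) + 1)‖) /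
          (t ^ n * ((Real.log |t|) ^ 2 + Real.pi ^ 2))))) := by
  obtain ⟨n, rfl⟩ : ∃ q, n = q + 1 := ⟨n - 1, by omega⟩
  obtain ⟨p, rfl⟩ : ∃ p, k = p + 1 := ⟨k - 1, by omega⟩
  obtain ⟨ht1, ht2⟩ := ht
  push_cast at ht1 ht2
  have ht0 : t < 0 := by linarith [(Nat.cast_nonneg p : (0 : ℝ) ≤ p)]
  have hm : ∀ m : ℕ, (t : ℂ) + 1 ≠ -m := by
    intro m h
    have h1 : t + 1 = -(m : ℝ) := by exact_mod_cast h
    have h2 : (m : ℝ) < p := by linarith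
    have h3 : (p : ℝ) < m + 1 := by linarith
    have h4 : m < p := by exact_mod_cast h2
    have h5 : p < m + 1 := by exact_mod_cast h3
    omega
  -- The argument is t + 1, one unit to the right of t; hence k - 1 in the Pochhammer symbol.
  have him := multiGammaLog_im p (n + 1) (Or.inl n.succ_ne_zero) (t + 1)
    ⟨by linarith, by linarith⟩
  have hre := multiGammaLog_re (n + 1) hm
  push_cast at him
  have h := (Complex.continuous_im.tendsto _).comp (tendsto_pickF n ht0 hm)
  rw [im_div_pow_mul_log ht0, him, hre] at h
  refine Eq.subst (motive := fun y => Filter.Tendsto _ _ (𝓝 y)) ?_ h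
  rw [Nat.cast_add_one p, add_sub_cancel_right]
  ring
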